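/- Let $m>0$. Let $M$ be the maximally extended Schwarzschild manifold of mass $m$: the points $(r,u,v,\omega)$ with $r>0$, $u,v\in\mathbb{R}$, $\omega\in S^2$ and $uv=(1-\frac{r}{2m})e^{r/2m}$, with the metric $g=\frac{32m^3}{r}e^{-r/2m}\,du\,dv-r^2\gamma_{S^2}$. The exterior region is $u<0<v$, where $u=-\sqrt{r/2m-1}\,e^{(r-t)/4m}$, $v=\sqrt{r/2m-1}\,e^{(r+t)/4m}$ and $g=(1-\frac{2m}{r})dt^2-(1-\frac{2m}{r})^{-1}dr^2-r^2\gamma_{S^2}$. Let $\overline{M}$ be the conformal compactification obtained by rescaling $g$ by $1/r^2$ and adding to $M$ the null infinities of the exterior region, namely past null infinity $(\mathcal{I}_-)^{Schw}=\{r=\infty,\ u=-\infty,\ 0<v<\infty\}$ and future null infinity $(\mathcal{I}_+)^{Schw}=\{r=\infty,\ v=+\infty,\ -\infty<u<0\}$ (near them $(1/r,v,\omega)$ and $(1/r,u,\omega)$, respectively, are charts of a manifold with boundary). Let $\iota:M\to\mathbb{R}^{4,1}$ be the conformal embedding $\iota(r,u,v,\omega)=(T,X,R\,\omega)$ given by $$T+X=4\sqrt2\Big(\frac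 mr\Big)^{3/2}e^{-r/4m}h(r)\,v,\qquad T-X=4\sqrt2\Big(\frac mr\Big)^{3/2}e^{-r/4m}h(r)\,u,\qquad R=h(r),$$ where $h(r)=\exp\big(\int\frac{p(r)}{q(r)}dr\big)$ with $$p=48m^3-16m^2r-r^{3/2}\sqrt{r^3+2mr^2+4m^2r+72m^3},\qquad q=(32m^3-16m^2r-r^3)\,r,$$ the constant of integration being fixed by $h(r)/r\to1$ as $r\to\infty$; that is, $h(r)=r\exp\big(-\int_r^\infty(\frac{p(s)}{q(s)}-\frac1s)ds\big)$. In the exterior region this is $T=\frac{4m}{r}h\sqrt{1-\frac{2m}{r}}\sinh\frac{t}{4m}$, $X=\frac{4m}{r}h\sqrt{1-\frac{2m}{r}}\cosh\frac{t}{4m}$. For a point $(T,x)$ of $\mathbb{R}^{4,1}=\mathbb{R}\times\mathbb{R}^4$ put $\rho=|x|$, $U=T-\rho$, $V=T+\rho$. Embed $\mathbb{R}^{4,1}$ conformally in the Einstein cylinder $\mathbb{R}\times S^4$ by $$(T,x)\mapsto\big(\tau,\ (\cos\chi,\ \sin\chi\,\tfrac{x}{\rho})\big),\qquad \tau=\arctan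 V+\arctan U,\quad \chi=\arctan V-\arctan U,$$ and let $\overline{\mathbb{R}}^{4,1}$ be the closure of the image. Its past null infinity $(\mathcal{I}_-)^5\cong\mathbb{R}\times S^3$ consists of the points with $\arctan U=-\pi/2$ and coordinates $(V,n)$, and its future null infinity $(\mathcal{I}_+)^5\cong\mathbb{R}\times S^3$ of the points with $\arctan V=\pi/2$ and coordinates $(U,n)$, where $n\in S^3$ is the direction. Let $N\in S^3$ be the north pole, that is, the direction of the positive $X$-axis. Then $\iota$ extends to a continuous map $\overline{\iota}:\overline{M}\to\overline{\mathbb{R}}^{4,1}$ such that $\overline{\iota}\big((\mathcal{I}_-)^{Schw}\big)=\{p_-\}$ and $\overline{\iota}\big((\mathcal{I}_+)^{Schw}\big)=\{p_+\}$, where $p_-\in(\mathcal{I}_-)^5$ is the point with coordinates $(V,n)=(0,N)$ and $p_+\in(\mathcal{I}_+)^5$ is the point with coordinates $(U,n)=(0,N)$. -/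

import Mathlib

open Set Real

/-- The unit sphere `S^2` in `ℝ^3`. -/
abbrev S2 : Type := Metric.sphere (0 : EuclideanSpace ℝ (Fin 3)) 1

/-- The unit sphere `S^3` in the space `ℝ^4` of the coordinates `(X, X₂, X₃, X₄)`. -/
abbrev S3 : Type := Metric.sphere (0 : EuclideanSpace ℝ (Fin 4)) 1

/-- Minkowski space `ℝ^{4,1}`: pairs `(T, x)` with `x = (X, X₂, X₃, X₄)` and the flat metric
`dT² - |dx|²`. -/
abbrev Mink : Type := ℝ × EuclideanSpace ℝ (Fin 4)

/-- The Einstein cylinder `ℝ × S^4`, with metric `dτ² - γ_{S^4}`. -/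
abbrev EinsteinCylinder : Type := ℝ × Metric.sphere (0 : EuclideanSpace ℝ (Fin 5)) 1

noncomputable section

/-! ### The Schwarzschild manifold and its conformal embedding -/

/-- The maximally extended Schwarzschild manifold of mass `m` in Kruskal coordinates: points
`(r, u, v, ω)` with `r > 0`, `ω ∈ S^2` and `u v = (1 - r/2m) e^{r/2m}` (an equation which
determines `r` from `u v < 1`). The metric is `(32 m³/r) e^{-r/2m} du dv - r² γ_{S^2}`. On the
exterior region `u < 0 < v`, where
`u = -√(r/2m - 1) e^{(r-t)/4m}` and `v = √(r/2m - 1) e^{(r+t)/4m}`, it is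
`(1 - 2m/r) dt² - (1 - 2m/r)⁻¹ dr² - r² γ_{S^2}`. -/
def Schw (m : ℝ) : Type :=
  {x : ℝ × ℝ × ℝ × S2 // 0 < x.1 ∧
    x.2.1 * x.2.2.1 = (1 - x.1 / (2 * m)) * exp (x.1 / (2 * m))}

/-- The numerator of `h' / h`. -/
def pFun (m r : ℝ) : ℝ :=
  48 * m ^ 3 - 16 * m ^ 2 * r
    - r ^ (3 / 2 : ℝ) * √(r ^ 3 + 2 * m * r ^ 2 + 4 * m ^ 2 * r + 72 * m ^ 3)

/-- The denominator of `h' / h`. -/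
def qFun (m r : ℝ) : ℝ := (32 * m ^ 3 - 16 * m ^ 2 * r - r ^ 3) * r

/-- The radial function `h(r) = exp (∫ p/q dr)`, with the constant of integration fixed by
`h(r)/r → 1` as `r → ∞`. (The singularity of `p/q` at the real root of `q` is removable, and
`p/q - 1/s = O(s⁻²)` at infinity.) -/
def hFun (m r : ℝ) : ℝ :=
  r * exp (-∫ s in Ioi r, (pFun m s / qFun m s - 1 / s))

/-- The common factor `4√2 (m/r)^{3/2} e^{-r/4m} h(r)` of `T + X` and `T - X`. -/
def kFun (m r : ℝ) : ℝ :=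
  4 * √2 * (m / r) ^ (3 / 2 : ℝ) * exp (-r / (4 * m)) * hFun m r

/-- The conformal embedding of Schwarzschild in `ℝ^{4,1}`:
`T - X = k(r) u`, `T + X = k(r) v`, `(X₂, X₃, X₄) = h(r) ω`. On the exterior region this reads
`T = (4m/r) h √(1 - 2m/r) sinh (t/4m)`, `X = (4m/r) h √(1 - 2m/r) cosh (t/4m)`, `R = h`. The flat
metric pulls back to `Ω²` times the Schwarzschild metric, with `Ω = h(r)/r`. -/
def schwEmbedding (m : ℝ) (x : Schw m) : Mink :=
  let r := x.1.1
  let u := x.1.2.1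
  let v := x.1.2.2.1
  let ω : EuclideanSpace ℝ (Fin 3) := x.1.2.2.2
  (kFun m r * (v + u) / 2,
    !₂[kFun m r * (v - u) / 2, hFun m r * ω 0, hFun m r * ω 1, hFun m r * ω 2])

/-! ### The conformal compactification of Schwarzschild -/

/-- The Schwarzschild manifold together with the past and future null infinity of the asymptotically
flat exterior region `u < 0 < v`. A point is described by `(ℓ, u, v, ω)` with `ℓ = 1/r`:
* points of the Schwarzschild manifold have `ℓ > 0` and real `u`, `v`;
* points of past null infinity have `ℓ = 0` (that is `r = ∞`), `u = -∞`, and finite `v > 0`;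
* points of future null infinity have `ℓ = 0`, `v = +∞`, and finite `u < 0`.
The topology is that of the manifold with boundary obtained from the conformal rescaling
`ℓ² g`: near past null infinity `(ℓ, v, ω)` with `ℓ ≥ 0` is a chart, in which, with the advanced
time `w = 4m log v`, the rescaled metric `ℓ² (1 - 2mℓ) dw² + 2 dw dℓ - γ_{S^2}` is regular up to
`ℓ = 0`; near future null infinity `(ℓ, u, ω)` is such a chart. -/
def SchwBar (m : ℝ) : Type :=
  {z : ℝ × EReal × EReal × S2 //
    (∃ x : Schw m, z = (1 / x.1.1, (x.1.2.1 : EReal), (x.1.2.2.1 : EReal), x.1.2.2.2)) ∨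
    (∃ (v : ℝ) (ω : S2), 0 < v ∧ z = (0, ⊥, (v : EReal), ω)) ∨
    (∃ (u : ℝ) (ω : S2), u < 0 ∧ z = (0, (u : EReal), ⊤, ω))}

instance (m : ℝ) : TopologicalSpace (SchwBar m) := instTopologicalSpaceSubtype

/-- The inclusion of the Schwarzschild manifold in its compactification. -/
def Schw.toBar {m : ℝ} (x : Schw m) : SchwBar m :=
  ⟨(1 / x.1.1, (x.1.2.1 : EReal), (x.1.2.2.1 : EReal), x.1.2.2.2), Or.inl ⟨x, rfl⟩⟩

/-- Past null infinity of Schwarzschild. -/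
def scriPastSchw (m : ℝ) : Set (SchwBar m) :=
  {z | ∃ (v : ℝ) (ω : S2), 0 < v ∧ z.1 = (0, ⊥, (v : EReal), ω)}

/-- Future null infinity of Schwarzschild. -/
def scriFutureSchw (m : ℝ) : Set (SchwBar m) :=
  {z | ∃ (u : ℝ) (ω : S2), u < 0 ∧ z.1 = (0, (u : EReal), ⊤, ω)}

/-! ### The conformal compactification of `ℝ^{4,1}` -/

/-- The point of `S^4` at polar angle `χ` in the direction `n`, i.e. `(cos χ, sin χ n)`. If `n` is
the zero vector (which occurs below only with `χ = 0`) the value is the pole `(1, 0)`. -/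
def polarPoint (χ : ℝ) (n : EuclideanSpace ℝ (Fin 4)) (hn : ‖n‖ = 1 ∨ (n = 0 ∧ sin χ = 0 ∧ cos χ = 1)) :
    Metric.sphere (0 : EuclideanSpace ℝ (Fin 5)) 1 :=
  ⟨!₂[cos χ, sin χ * n 0, sin χ * n 1, sin χ * n 2, sin χ * n 3], by
    have key : cos χ ^ 2 + (sin χ * n 0) ^ 2 + (sin χ * n 1) ^ 2 + (sin χ * n 2) ^ 2
        + (sin χ * n 3) ^ 2 = 1 := by
      rcases hn with hn | ⟨-, hs, hc⟩
      · have h2 : n 0 ^ 2 + n 1 ^ 2 + n 2 ^ 2 + n 3 ^ 2 = 1 := by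
          have := EuclideanSpace.real_norm_sq_eq n
          rw [hn, Fin.sum_univ_four] at this
          linarith
        linear_combination sin χ ^ 2 * h2 + Real.sin_sq_add_cos_sq χ
      · simp [hs, hc]
    rw [mem_sphere_zero_iff_norm, EuclideanSpace.norm_eq, Real.sqrt_eq_one, Fin.sum_univ_five]
    simpa [mul_pow] using key⟩

/-- The conformal map of Minkowski space into the Einstein cylinder: with `ρ = |x|`,
`U = T - ρ`, `V = T + ρ`, it is given by `τ = arctan V + arctan U`, `χ = arctan V - arctan U`, and the
direction `x/ρ ∈ S^3`. -/
def penroseMap (y : Mink) : EinsteinCylinder :=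
  (arctan (y.1 + ‖y.2‖) + arctan (y.1 - ‖y.2‖),
    polarPoint (arctan (y.1 + ‖y.2‖) - arctan (y.1 - ‖y.2‖)) (‖y.2‖⁻¹ • y.2) (by
      by_cases h : y.2 = 0
      · right; simp [h]
      · left; rw [norm_smul, norm_inv, norm_norm, inv_mul_cancel₀ (norm_ne_zero_iff.mpr h)]))

/-- The compactification of `ℝ^{4,1}`: the closure of its image in the Einstein cylinder. -/
def MinkBar : Type := closure (range penroseMap)

instance : TopologicalSpace MinkBar := instTopologicalSpaceSubtype

/-- The inclusion of Minkowski space in its compactification. -/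
def Mink.toBar (y : Mink) : MinkBar := ⟨penroseMap y, subset_closure (mem_range_self y)⟩

/-- The point of past null infinity with coordinates `(V, n)`: `U = -∞`, that is
`arctan U = -π/2`, with `V` finite. -/
def scriPastPoint (V : ℝ) (n : S3) : EinsteinCylinder :=
  (arctan V - π / 2, polarPoint (arctan V + π / 2) n.1 (Or.inl (mem_sphere_zero_iff_norm.mp n.2)))

/-- The point of future null infinity with coordinates `(U, n)`: `V = +∞`, that is
`arctan V = π/2`, with `U` finite. -/
def scriFuturePoint (U : ℝ) (n : S3) : EinsteinCylinder :=
  (π / 2 + arctan U, polarPoint (π / 2 - arctan U) n.1 (Or.inl (mem_sphere_zero_iff_norm.mp n.2)))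

/-- Past null infinity of `ℝ^{4,1}`, a copy of `ℝ × S^3`. -/
def scriPastMink : Set MinkBar := {z | ∃ (V : ℝ) (n : S3), z.1 = scriPastPoint V n}

/-- Future null infinity of `ℝ^{4,1}`, a copy of `ℝ × S^3`. -/
def scriFutureMink : Set MinkBar := {z | ∃ (U : ℝ) (n : S3), z.1 = scriFuturePoint U n}

/-- The north pole `ψ = 0` of `S^3`, where `X = ρ cos ψ`: the direction of the positive `X` axis. -/
def northPole : S3 := ⟨EuclideanSpace.single 0 1, by simp⟩

end

open Filter Topology MeasureTheory

/-! Everything rests on the competition between exponentials in `r`. Since `p/q - 1/r` is `O(r⁻²)`,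
`h` grows like `r`, so `k = kFun` decays like `e^{-r/4m}` up to powers of `r`, while `-uv` grows
like `r e^{r/2m}`. Put `a = T + X = k v` and `b = T - X = k u`. Towards past null infinity `v` stays
finite, so `a → 0`, whereas `-b` grows like `e^{r/4m}` up to powers of `r` and `h²/(-b) → 0`.

The identity `(T + ρ)(T - ρ) = ab - h²` then traps `V = T + ρ` between `a` and `a + h²/(-b)`, and `ρ
≥ X` gives `U ≤ b → -∞`. Since `h/(a - b) → 0`, the direction tends to `N`. The limit is independent
of `v` and `ω`, so all of past null infinity collapses to one point; the future case is symmetric.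

The estimates are `exists_hFun_bounds` and `tendsto_hFun_sq_div`, the geometry is
`tendsto_penroseMap_nullMink_past` and `tendsto_penroseMap_nullMink_future`, and
`continuous_schwExtension` assembles them. -/

noncomputable section

/-! ### Rationalisation of `p/q` and its decay at infinity. -/

/-- The irrational part of the numerator `pFun`. -/
def radicalFun (m r : ℝ) : ℝ :=
  r ^ (3 / 2 : ℝ) * √(r ^ 3 + 2 * m * r ^ 2 + 4 * m ^ 2 * r + 72 * m ^ 3)

/-- The function `p / q` with its removable singularity removed. -/
def logDerivFun (m r : ℝ) : ℝ :=
  (r ^ 3 + 2 * m * r ^ 2 - 12 * m ^ 2 * r + 72 * m ^ 3) /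
    ((48 * m ^ 3 - 16 * m ^ 2 * r + radicalFun m r) * r)

lemma radicalFun_nonneg {m r : ℝ} (hr : 0 < r) : 0 ≤ radicalFun m r := by
  unfold radicalFun; positivity

lemma radicalFun_sq {m r : ℝ} (hm : 0 < m) (hr : 0 < r) :
    radicalFun m r ^ 2 = r ^ 3 * (r ^ 3 + 2 * m * r ^ 2 + 4 * m ^ 2 * r + 72 * m ^ 3) := by
  unfold radicalFun
  rw [mul_pow, Real.sq_sqrt (by positivity), ← Real.rpow_natCast, ← Real.rpow_mul hr.le]
  norm_num

lemma logDeriv_numerator_pos {m r : ℝ} (hm : 0 < m) (hr : 0 < r) :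
    0 < r ^ 3 + 2 * m * r ^ 2 - 12 * m ^ 2 * r + 72 * m ^ 3 := by
  have h : r ^ 3 + 2 * m * r ^ 2 - 12 * m ^ 2 * r + 72 * m ^ 3
      = r ^ 3 + 2 * m * (r - 3 * m) ^ 2 + 54 * m ^ 3 := by ring
  rw [h]; positivity

/-- Multiplying `p` by its conjugate produces the cubic factor of `q`; cancelling it removes the
singularity of `p/q`. -/
lemma sq_sub_radicalFun_sq {m r : ℝ} (hm : 0 < m) (hr : 0 < r) :
    (48 * m ^ 3 - 16 * m ^ 2 * r) ^ 2 - radicalFun m r ^ 2 =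
      (32 * m ^ 3 - 16 * m ^ 2 * r - r ^ 3) *
        (r ^ 3 + 2 * m * r ^ 2 - 12 * m ^ 2 * r + 72 * m ^ 3) := by
  rw [radicalFun_sq hm hr]; ring

/-- Write the sum as `A + B` with `B = radicalFun m r`. For `r ≤ 3m` one has `A ≥ 0` and `B > 0`.
For `r > 3m` the cubic factor of `q` is negative, so `A² < B²` and `A > -B`. -/
lemma logDeriv_denominator_pos {m r : ℝ} (hm : 0 < m) (hr : 0 < r) :
    0 < 48 * m ^ 3 - 16 * m ^ 2 * r + radicalFun m r := by
  have hB := radicalFun_nonneg (m := m) hr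
  have hsq := radicalFun_sq hm hr
  rcases le_or_gt r (3 * m) with h | h
  · have hA : 0 ≤ 48 * m ^ 3 - 16 * m ^ 2 * r := by
      have : 0 ≤ 16 * m ^ 2 * (3 * m - r) := mul_nonneg (by positivity) (by linarith)
      linarith
    have hB' : 0 < radicalFun m r := by
      refine lt_of_le_of_ne hB fun h0 => ?_
      rw [← h0] at hsq
      have : 0 < r ^ 3 * (r ^ 3 + 2 * m * r ^ 2 + 4 * m ^ 2 * r + 72 * m ^ 3) := by positivity
      linarith
    linarith
  · have hD : 32 * m ^ 3 - 16 * m ^ 2 * r - r ^ 3 < 0 := by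
      have h1 : 0 < 16 * m ^ 2 * (r - 3 * m) := mul_pos (by positivity) (by linarith)
      have h2 : 0 < r ^ 3 := by positivity
      have h3 : 0 < m ^ 3 := by positivity
      linarith
    have := mul_neg_of_neg_of_pos hD (logDeriv_numerator_pos hm hr)
    rw [← sq_sub_radicalFun_sq hm hr] at this
    have := abs_lt_of_sq_lt_sq' (by linarith : (48 * m ^ 3 - 16 * m ^ 2 * r) ^ 2 < _) hB
    linarith [this.1]

lemma pFun_div_qFun {m r : ℝ} (hm : 0 < m) (hr : 0 < r)
    (hD : 32 * m ^ 3 - 16 * m ^ 2 * r - r ^ 3 ≠ 0) :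
    pFun m r / qFun m r = logDerivFun m r := by
  have hp : pFun m r = 48 * m ^ 3 - 16 * m ^ 2 * r - radicalFun m r := rfl
  have h1 := (logDeriv_denominator_pos hm hr).ne'
  have h2 := sq_sub_radicalFun_sq hm hr
  rw [hp, qFun, logDerivFun, div_eq_div_iff (mul_ne_zero hD hr.ne') (mul_ne_zero h1 hr.ne')]
  linear_combination r * h2

lemma radicalFun_ge {m r : ℝ} (hm : 0 < m) (hr : 0 < r) : r ^ 3 ≤ radicalFun m r := by
  refine (sq_le_sq₀ (by positivity) (radicalFun_nonneg hr)).mp ?_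
  rw [radicalFun_sq hm hr]
  have : 0 ≤ r ^ 3 * (2 * m * r ^ 2 + 4 * m ^ 2 * r + 72 * m ^ 3) := by positivity
  linarith

lemma radicalFun_le {m r : ℝ} (hm : 0 < m) (hr : 0 < r) :
    radicalFun m r ≤ r ^ 3 + m * r ^ 2 + 2 * m ^ 2 * r + 36 * m ^ 3 := by
  refine (sq_le_sq₀ (radicalFun_nonneg hr) (by positivity)).mp ?_
  rw [radicalFun_sq hm hr]
  have : 0 ≤ (m * r ^ 2 + 2 * m ^ 2 * r + 36 * m ^ 3) ^ 2 := by positivity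
  linarith

lemma abs_logDerivFun_sub_le {m r : ℝ} (hm : 0 < m) (hr : 6 * m ≤ r) :
    |logDerivFun m r - 1 / r| ≤ 8 * m * r ^ (-2 : ℝ) := by
  have hr0 : 0 < r := by linarith
  have h1 := logDeriv_denominator_pos hm hr0
  have h2 := radicalFun_ge hm hr0
  have h3 := radicalFun_le hm hr0
  have a1 : m ^ 2 * (6 * m) ≤ m ^ 2 * r := by gcongr
  have a2 : m * r * (6 * m) ≤ m * r * r := by gcongr
  have a3 : r * (6 * m) ^ 2 ≤ r * r ^ 2 := by gcongr
  have a4 : 0 < m * r ^ 2 := by positivity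
  have a5 : 0 < m ^ 3 := by positivity
  -- From `r ≥ 6m`, `r³/2 ≥ 18 m² r` absorbs the term `16 m² r`.
  have hlow : r ^ 3 / 2 ≤ 48 * m ^ 3 - 16 * m ^ 2 * r + radicalFun m r := by nlinarith
  -- The leading `r³` cancels against that of `radicalFun`, leaving a quantity of order `m r²`.
  have hnum : |r ^ 3 + 2 * m * r ^ 2 - 12 * m ^ 2 * r + 72 * m ^ 3
      - (48 * m ^ 3 - 16 * m ^ 2 * r + radicalFun m r)| ≤ 4 * m * r ^ 2 := by
    rw [abs_le]; constructor <;> nlinarith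
  have hEq : logDerivFun m r - 1 / r = (r ^ 3 + 2 * m * r ^ 2 - 12 * m ^ 2 * r + 72 * m ^ 3
      - (48 * m ^ 3 - 16 * m ^ 2 * r + radicalFun m r)) /
        ((48 * m ^ 3 - 16 * m ^ 2 * r + radicalFun m r) * r) := by
    have : 1 / r = (48 * m ^ 3 - 16 * m ^ 2 * r + radicalFun m r) /
        ((48 * m ^ 3 - 16 * m ^ 2 * r + radicalFun m r) * r) := by
      rw [div_mul_cancel_left₀ h1.ne', one_div]
    rw [this, logDerivFun, ← sub_div]
  have hpow : r ^ (-2 : ℝ) = 1 / r ^ 2 := by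
    rw [Real.rpow_neg hr0.le]; norm_num
  rw [hEq, abs_div, abs_of_pos (mul_pos h1 hr0), hpow]
  calc _ ≤ 4 * m * r ^ 2 / (r ^ 3 / 2 * r) := by gcongr
    _ = _ := by field_simp; ring

lemma continuousOn_logDerivFun_sub {m : ℝ} (hm : 0 < m) :
    ContinuousOn (fun r => logDerivFun m r - 1 / r) (Ioi 0) := by
  have h : ContinuousOn (radicalFun m) (Ioi 0) := by
    unfold radicalFun
    refine ContinuousOn.mul ?_ (by fun_prop)
    exact ContinuousOn.rpow_const continuousOn_id fun x hx => Or.inl (ne_of_gt hx)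
  unfold logDerivFun
  refine ContinuousOn.sub (ContinuousOn.div (by fun_prop) (by fun_prop) fun r hr => ?_)
    (ContinuousOn.div (by fun_prop) (by fun_prop) fun r hr => ne_of_gt hr)
  exact mul_ne_zero (logDeriv_denominator_pos hm hr).ne' (ne_of_gt hr)

lemma integrableOn_logDerivFun_sub {m a : ℝ} (hm : 0 < m) (ha : 0 < a) :
    IntegrableOn (fun r => logDerivFun m r - 1 / r) (Ioi a) := by
  have h1 : IntegrableOn (fun r => logDerivFun m r - 1 / r) (Icc a (6 * m)) :=
    ((continuousOn_logDerivFun_sub hm).mono fun x hx => lt_of_lt_of_le ha hx.1).integrableOn_Icc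
  have h2 : IntegrableOn (fun r => logDerivFun m r - 1 / r) (Ioi (6 * m)) := by
    refine Integrable.mono' (g := fun r => 8 * m * r ^ (-2 : ℝ))
      ((integrableOn_Ioi_rpow_of_lt (by norm_num) (by positivity)).const_mul _) ?_ ?_
    · exact ((continuousOn_logDerivFun_sub hm).mono
        (Ioi_subset_Ioi (by positivity))).aestronglyMeasurable measurableSet_Ioi
    · filter_upwards [ae_restrict_mem measurableSet_Ioi] with r hr
      exact abs_logDerivFun_sub_le hm (le_of_lt hr)
  refine (h1.union h2).mono_set fun x hx => ?_
  rcases le_or_gt x (6 * m) with h | h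
  · exact Or.inl ⟨le_of_lt hx, h⟩
  · exact Or.inr h

/-! ### Continuity and growth of `h` and `k`. -/

lemma injective_cubic (m : ℝ) :
    Function.Injective fun s : ℝ => 32 * m ^ 3 - 16 * m ^ 2 * s - s ^ 3 := by
  refine StrictAnti.injective fun a b hab => ?_
  have h1 : a ^ 3 < b ^ 3 := Odd.strictMono_pow (by decide) hab
  have h2 : 16 * m ^ 2 * a ≤ 16 * m ^ 2 * b := by gcongr
  show 32 * m ^ 3 - 16 * m ^ 2 * b - b ^ 3 < 32 * m ^ 3 - 16 * m ^ 2 * a - a ^ 3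
  linarith

/-- The cubic factor of `q` has at most one real zero, so the integrands agree almost everywhere;
the conventional value of `p/q` at that zero is immaterial. -/
lemma hFun_eq {m r : ℝ} (hm : 0 < m) (hr : 0 < r) :
    hFun m r = r * exp (-∫ s in Ioi r, (logDerivFun m s - 1 / s)) := by
  unfold hFun
  congr 3
  refine integral_congr_ae ?_
  have hnull : volume {s : ℝ | 32 * m ^ 3 - 16 * m ^ 2 * s - s ^ 3 = 0} = 0 := by
    refine Set.Subsingleton.measure_zero (fun a ha b hb => injective_cubic m ?_) _
    exact (show _ = (0 : ℝ) from ha).trans (show _ = (0 : ℝ) from hb).symm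
  filter_upwards [ae_restrict_mem measurableSet_Ioi,
    ae_restrict_of_ae (measure_eq_zero_iff_ae_notMem.mp hnull)]
    with s hs hD
  rw [pFun_div_qFun hm (hr.trans hs) hD]

lemma hFun_pos {m r : ℝ} (hr : 0 < r) : 0 < hFun m r := mul_pos hr (exp_pos _)

lemma continuousAt_hFun {m r : ℝ} (hm : 0 < m) (hr : 0 < r) : ContinuousAt (hFun m) r := by
  have hI : ContinuousAt (fun b => ∫ s in Ioi b, (logDerivFun m s - 1 / s)) r :=
    ((integrableOn_logDerivFun_sub hm (half_pos hr)).continuousOn_Ici_primitive_Ioi).continuousAt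
      (Ici_mem_nhds (by linarith))
  have : ContinuousAt (fun r => r * exp (-∫ s in Ioi r, (logDerivFun m s - 1 / s))) r :=
    continuousAt_id.mul (continuous_exp.continuousAt.comp hI.neg)
  refine this.congr ?_
  filter_upwards [Ioi_mem_nhds hr] with s hs
  exact (hFun_eq hm hs).symm

/-- `h(r)` is comparable to `r` at infinity. -/
lemma exists_hFun_bounds {m : ℝ} (hm : 0 < m) :
    ∃ C : ℝ, 0 < C ∧ ∀ r, 6 * m ≤ r → r / C ≤ hFun m r ∧ hFun m r ≤ C * r := by
  -- The exponent in `h(r)/r` is bounded by this `L¹` norm, hence the constant `C = e^K`.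
  -- Comparability suffices below; the exact limit of `h/r` is not needed.
  set K := ∫ s in Ioi (6 * m), ‖logDerivFun m s - 1 / s‖
  have hint := integrableOn_logDerivFun_sub (a := 6 * m) hm (by positivity)
  refine ⟨exp K, exp_pos _, fun r hr => ?_⟩
  have hr0 : 0 < r := by linarith
  have hJ : |∫ s in Ioi r, (logDerivFun m s - 1 / s)| ≤ K :=
    (norm_integral_le_integral_norm _).trans
      (setIntegral_mono_set hint.norm (ae_of_all _ fun _ => norm_nonneg _)
        (Ioi_subset_Ioi hr).eventuallyLE)
  rw [abs_le] at hJ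
  rw [hFun_eq hm hr0, div_eq_mul_inv, ← exp_neg, mul_comm (exp K)]
  constructor <;> gcongr <;> linarith

lemma kFun_pos {m r : ℝ} (hm : 0 < m) (hr : 0 < r) : 0 < kFun m r := by
  have := hFun_pos (m := m) hr
  unfold kFun; positivity

lemma continuousAt_kFun {m r : ℝ} (hm : 0 < m) (hr : 0 < r) : ContinuousAt (kFun m) r := by
  have h1 : ContinuousAt (fun r : ℝ => (m / r) ^ (3 / 2 : ℝ)) r :=
    (continuousAt_const.div continuousAt_id hr.ne').rpow_const (Or.inr (by norm_num))
  have h2 : ContinuousAt (fun r : ℝ => exp (-r / (4 * m))) r := by fun_prop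
  exact ((continuousAt_const.mul h1).mul h2).mul (continuousAt_hFun hm hr)

lemma tendsto_pow_mul_exp_neg_div {m : ℝ} (hm : 0 < m) (n : ℕ) :
    Tendsto (fun r : ℝ => r ^ n * exp (-r / (4 * m))) atTop (𝓝 0) := by
  have := tendsto_rpow_mul_exp_neg_mul_atTop_nhds_zero n (1 / (4 * m)) (by positivity)
  refine this.congr fun r => ?_
  rw [Real.rpow_natCast]
  congr 2
  ring

lemma tendsto_hFun_atTop {m : ℝ} (hm : 0 < m) : Tendsto (hFun m) atTop atTop := by
  obtain ⟨C, hC, hb⟩ := exists_hFun_bounds hm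
  refine tendsto_atTop_mono' _ ?_ (tendsto_id.atTop_div_const hC)
  filter_upwards [eventually_ge_atTop (6 * m)] with r hr using (hb r hr).1

lemma tendsto_kFun_atTop {m : ℝ} (hm : 0 < m) : Tendsto (kFun m) atTop (𝓝 0) := by
  obtain ⟨C, hC, hb⟩ := exists_hFun_bounds hm
  have h0 : Tendsto (fun r : ℝ => 4 * √2 * C * (r ^ 1 * exp (-r / (4 * m)))) atTop (𝓝 0) := by
    simpa using (tendsto_pow_mul_exp_neg_div hm 1).const_mul (4 * √2 * C)
  refine squeeze_zero' ?_ ?_ h0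
  · filter_upwards [eventually_gt_atTop 0] with r hr using (kFun_pos hm hr).le
  · filter_upwards [eventually_ge_atTop (6 * m)] with r hr
    have hr0 : 0 < r := by linarith
    have h1 : (m / r) ^ (3 / 2 : ℝ) ≤ 1 :=
      Real.rpow_le_one (by positivity) ((div_le_one hr0).mpr (by linarith)) (by norm_num)
    have h2 := hFun_pos (m := m) hr0
    calc kFun m r ≤ 4 * √2 * 1 * exp (-r / (4 * m)) * (C * r) := by
          unfold kFun; gcongr; exact (hb r hr).2
      _ = _ := by ring

/-- On the exterior region this is the limit of `h² v / (T - X)` and `h² u / (T + X)` at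
infinity, up to sign. -/
lemma tendsto_hFun_sq_div {m : ℝ} (hm : 0 < m) :
    Tendsto (fun r => hFun m r ^ 2 / (kFun m r * ((r / (2 * m) - 1) * exp (r / (2 * m)))))
      atTop (𝓝 0) := by
  obtain ⟨C, hC, hb⟩ := exists_hFun_bounds hm
  have h0 : Tendsto (fun r : ℝ => C / m ^ 2 * (r ^ 3 * exp (-r / (4 * m)))) atTop (𝓝 0) := by
    simpa using (tendsto_pow_mul_exp_neg_div hm 3).const_mul (C / m ^ 2)
  refine squeeze_zero' ?_ ?_ h0
  · filter_upwards [eventually_ge_atTop (6 * m)] with r hr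
    have hr0 : 0 < r := by linarith
    have h1 : 0 ≤ r / (2 * m) - 1 := by
      rw [sub_nonneg, le_div_iff₀ (by positivity)]; linarith
    have := kFun_pos hm hr0
    positivity
  · filter_upwards [eventually_ge_atTop (6 * m)] with r hr
    have hr0 : 0 < r := by linarith
    have h1 : 1 ≤ r / (2 * m) - 1 := by
      rw [le_sub_iff_add_le, le_div_iff₀ (by positivity)]; linarith
    have h2 := hFun_pos (m := m) hr0
    -- As `m/r ≤ 1`, the fractional power may be lowered to an integer one, which keeps the majorant
    -- of the form `r³ e^{-r/4m}`.
    have h3 : (m / r) ^ 2 ≤ (m / r) ^ (3 / 2 : ℝ) := by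
      rw [← Real.rpow_natCast]
      exact Real.rpow_le_rpow_of_exponent_ge (by positivity)
        ((div_le_one hr0).mpr (by linarith)) (by norm_num)
    have h4 : 1 ≤ 4 * √2 := by
      have : 1 ≤ √2 := Real.one_le_sqrt.mpr (by norm_num)
      linarith
    -- One factor cancels the decay of `k`; the other remains in the denominator and beats `h²/k`'s
    -- powers of `r`.
    have h5 : exp (r / (2 * m)) = exp (r / (4 * m)) * exp (r / (4 * m)) := by
      rw [← exp_add]; congr 1; field_simp; ring
    have h6 : exp (-r / (4 * m)) = (exp (r / (4 * m)))⁻¹ := by rw [← exp_neg, neg_div]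
    have hE := exp_pos (r / (4 * m))
    have hk0 := kFun_pos hm hr0
    have hk : 1 * (m / r) ^ 2 * exp (-r / (4 * m)) * hFun m r ≤ kFun m r := by
      unfold kFun; gcongr
    calc _ ≤ hFun m r ^ 2 / (1 * (m / r) ^ 2 * exp (-r / (4 * m)) * hFun m r *
            (1 * exp (r / (2 * m)))) := by gcongr
      _ = hFun m r * (r ^ 2 / m ^ 2 * exp (-r / (4 * m))) := by
          rw [h5, h6]; field_simp
      _ ≤ C * r * (r ^ 2 / m ^ 2 * exp (-r / (4 * m))) := by gcongr; exact (hb r hr).2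
      _ = _ := by ring

/-! ### Continuity and limits of the Penrose map. -/

lemma tendsto_polarPoint {α : Type*} {l : Filter α} {χ : α → ℝ} {n : α → EuclideanSpace ℝ (Fin 4)}
    {χ₀ : ℝ} {n₀ : EuclideanSpace ℝ (Fin 4)}
    (hn : ∀ i, ‖n i‖ = 1 ∨ (n i = 0 ∧ sin (χ i) = 0 ∧ cos (χ i) = 1))
    (hn₀ : ‖n₀‖ = 1 ∨ (n₀ = 0 ∧ sin χ₀ = 0 ∧ cos χ₀ = 1))
    (hχ : Tendsto χ l (𝓝 χ₀)) (hnt : Tendsto n l (𝓝 n₀)) :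
    Tendsto (fun i => polarPoint (χ i) (n i) (hn i)) l (𝓝 (polarPoint χ₀ n₀ hn₀)) := by
  rw [tendsto_subtype_rng]
  have hc : Continuous fun p : ℝ × EuclideanSpace ℝ (Fin 4) =>
      (!₂[cos p.1, sin p.1 * p.2 0, sin p.1 * p.2 1, sin p.1 * p.2 2, sin p.1 * p.2 3] :
        EuclideanSpace ℝ (Fin 5)) := by
    refine (PiLp.continuous_toLp 2 _).comp (continuous_pi fun i => ?_)
    fin_cases i <;> simp <;> fun_prop
  have h := (hc.tendsto (χ₀, n₀)).comp (hχ.prodMk_nhds hnt)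
  simpa only [polarPoint, Function.comp_def] using h

/-- The axis `x = 0`, where the direction jumps, can be excluded: the embedding has `R = h > 0`. -/
lemma continuousAt_penroseMap {y : Mink} (hy : y.2 ≠ 0) : ContinuousAt penroseMap y := by
  have hd : ContinuousAt (fun y : Mink => ‖y.2‖⁻¹ • y.2) y :=
    (continuousAt_snd.norm.inv₀ (norm_ne_zero_iff.mpr hy)).smul continuousAt_snd
  refine ContinuousAt.prodMk ?_ (tendsto_polarPoint _ _ ?_ hd)
  · fun_prop
  · have : Continuous fun y : Mink => arctan (y.1 + ‖y.2‖) - arctan (y.1 - ‖y.2‖) := by fun_prop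
    exact this.tendsto y

lemma tendsto_penroseMap_scriPast {α : Type*} {l : Filter α} {y : α → Mink} {V : ℝ} {n : S3}
    (hV : Tendsto (fun i => (y i).1 + ‖(y i).2‖) l (𝓝 V))
    (hU : Tendsto (fun i => (y i).1 - ‖(y i).2‖) l atBot)
    (hn : Tendsto (fun i => ‖(y i).2‖⁻¹ • (y i).2) l (𝓝 n.1)) :
    Tendsto (fun i => penroseMap (y i)) l (𝓝 (scriPastPoint V n)) := by
  have hV' := (continuous_arctan.tendsto V).comp hV
  have hU' := (tendsto_nhds_of_tendsto_nhdsWithin tendsto_arctan_atBot).comp hU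
  refine Tendsto.prodMk_nhds ?_ (tendsto_polarPoint _ _ ?_ hn)
  · simpa [sub_eq_add_neg] using hV'.add hU'
  · simpa using hV'.sub hU'

lemma tendsto_penroseMap_scriFuture {α : Type*} {l : Filter α} {y : α → Mink} {U : ℝ} {n : S3}
    (hV : Tendsto (fun i => (y i).1 + ‖(y i).2‖) l atTop)
    (hU : Tendsto (fun i => (y i).1 - ‖(y i).2‖) l (𝓝 U))
    (hn : Tendsto (fun i => ‖(y i).2‖⁻¹ • (y i).2) l (𝓝 n.1)) :
    Tendsto (fun i => penroseMap (y i)) l (𝓝 (scriFuturePoint U n)) := by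
  have hU' := (continuous_arctan.tendsto U).comp hU
  have hV' := (tendsto_nhds_of_tendsto_nhdsWithin tendsto_arctan_atTop).comp hV
  refine Tendsto.prodMk_nhds ?_ (tendsto_polarPoint _ _ ?_ hn)
  · simpa using hV'.add hU'
  · simpa using hV'.sub hU'

/-! ### Estimates in the null coordinates `a = T + X`, `b = T - X`. -/

/-- The point of Minkowski space with `T + X = a`, `T - X = b` and `(X₂, X₃, X₄) = h ω`. -/
def nullMink (a b h : ℝ) (ω : S2) : Mink :=
  ((a + b) / 2, !₂[(a - b) / 2, h * ω.1 0, h * ω.1 1, h * ω.1 2])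

lemma norm_nullMink_sq (a b h : ℝ) (ω : S2) :
    ‖(nullMink a b h ω).2‖ ^ 2 = ((a - b) / 2) ^ 2 + h ^ 2 := by
  have hω : ω.1 0 ^ 2 + ω.1 1 ^ 2 + ω.1 2 ^ 2 = 1 := by
    have := EuclideanSpace.real_norm_sq_eq ω.1
    rw [mem_sphere_zero_iff_norm.mp ω.2, Fin.sum_univ_three] at this
    linarith
  rw [EuclideanSpace.real_norm_sq_eq, Fin.sum_univ_four]
  simp only [nullMink, Matrix.cons_val]
  linear_combination h ^ 2 * hω

lemma nullMink_snd_ne_zero {a b h : ℝ} (hh : 0 < h) (ω : S2) : (nullMink a b h ω).2 ≠ 0 := by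
  rw [← norm_ne_zero_iff, ← sq_pos_iff, norm_nullMink_sq]
  positivity

lemma continuous_nullMink : Continuous fun p : ℝ × ℝ × ℝ × S2 =>
    nullMink p.1 p.2.1 p.2.2.1 p.2.2.2 := by
  refine Continuous.prodMk (by fun_prop)
    ((PiLp.continuous_toLp 2 _).comp (continuous_pi fun i => ?_))
  fin_cases i <;> simp <;> fun_prop

lemma half_le_norm_nullMink (a b h : ℝ) (ω : S2) : (a - b) / 2 ≤ ‖(nullMink a b h ω).2‖ := by
  refine (abs_le_of_sq_le_sq' ?_ (norm_nonneg _)).2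
  rw [norm_nullMink_sq]
  linarith [sq_nonneg h]

lemma nullMink_sub_norm_le (a b h : ℝ) (ω : S2) :
    (nullMink a b h ω).1 - ‖(nullMink a b h ω).2‖ ≤ b := by
  have := half_le_norm_nullMink a b h ω
  have h1 : (nullMink a b h ω).1 = (a + b) / 2 := rfl
  linarith

lemma le_nullMink_add_norm (a b h : ℝ) (ω : S2) :
    a ≤ (nullMink a b h ω).1 + ‖(nullMink a b h ω).2‖ := by
  have := half_le_norm_nullMink a b h ω
  have h1 : (nullMink a b h ω).1 = (a + b) / 2 := rfl
  linarith

lemma nullMink_add_mul_sub (a b h : ℝ) (ω : S2) :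
    ((nullMink a b h ω).1 + ‖(nullMink a b h ω).2‖) *
      ((nullMink a b h ω).1 - ‖(nullMink a b h ω).2‖) = a * b - h ^ 2 := by
  have h1 : (nullMink a b h ω).1 = (a + b) / 2 := rfl
  have := norm_nullMink_sq a b h ω
  rw [h1]
  linear_combination -this

/-- With `V ≥ a > 0` and `-U ≥ -b > 0`, the product identity gives `V(-b) ≤ -UV = h² - ab`, that is
`(V - a)(-b) ≤ h²`. -/
lemma nullMink_add_norm_le {a b h : ℝ} (ha : 0 < a) (hb : b < 0) (ω : S2) :
    (nullMink a b h ω).1 + ‖(nullMink a b h ω).2‖ ≤ a + h ^ 2 / (-b) := by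
  have h1 := nullMink_sub_norm_le a b h ω
  have h2 := le_nullMink_add_norm a b h ω
  have h3 := nullMink_add_mul_sub a b h ω
  rw [← sub_le_iff_le_add', le_div_iff₀ (by linarith)]
  nlinarith

lemma le_nullMink_sub_norm {a b h : ℝ} (ha : 0 < a) (hb : b < 0) (ω : S2) :
    b - h ^ 2 / a ≤ (nullMink a b h ω).1 - ‖(nullMink a b h ω).2‖ := by
  have h1 := nullMink_sub_norm_le a b h ω
  have h2 := le_nullMink_add_norm a b h ω
  have h3 := nullMink_add_mul_sub a b h ω
  rw [sub_le_comm, le_div_iff₀ ha]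
  nlinarith

/-- For unit vectors the squared distance is `2 - 2X/ρ`. Here `X = (a - b)/2` and `X ≤ ρ ≤ X + h`,
so it is at most `2h/X`. -/
lemma norm_nullMink_direction_sub_sq_le {a b h : ℝ} (hab : b < a) (hh : 0 < h) (ω : S2) :
    ‖‖(nullMink a b h ω).2‖⁻¹ • (nullMink a b h ω).2 - northPole.1‖ ^ 2 ≤ 4 * (h / (a - b)) := by
  have h0 := norm_pos_iff.mpr (nullMink_snd_ne_zero (a := a) (b := b) hh ω)
  have h1 := half_le_norm_nullMink a b h ω
  have h2 := norm_nullMink_sq a b h ω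
  have hN : ‖northPole.1‖ = 1 := mem_sphere_zero_iff_norm.mp northPole.2
  have hin : inner ℝ (nullMink a b h ω).2 northPole.1 = (a - b) / 2 := by
    simp [northPole, nullMink, EuclideanSpace.inner_single_right]
  set ρ := ‖(nullMink a b h ω).2‖ with hρ
  have h3 : ρ ≤ (a - b) / 2 + h := by
    refine (abs_le_of_sq_le_sq' ?_ (by linarith)).2
    rw [h2]; nlinarith
  rw [norm_sub_sq_real, norm_smul, norm_inv, norm_norm, inner_smul_left, hin, hN, ← hρ,
    inv_mul_cancel₀ h0.ne']
  have h4 : 1 - ρ⁻¹ * ((a - b) / 2) ≤ h / ((a - b) / 2) := by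
    calc 1 - ρ⁻¹ * ((a - b) / 2) = (ρ - (a - b) / 2) / ρ := by field_simp
      _ ≤ h / ρ := by gcongr; linarith
      _ ≤ _ := by gcongr
  have h5 : h / ((a - b) / 2) = 2 * (h / (a - b)) := by field_simp
  simp only [RCLike.conj_to_real]
  linarith

lemma tendsto_nullMink_direction {α : Type*} {l : Filter α} {a b h : α → ℝ} {ω : α → S2}
    (hab : ∀ᶠ i in l, b i < a i) (hh : ∀ᶠ i in l, 0 < h i)
    (hlim : Tendsto (fun i => h i / (a i - b i)) l (𝓝 0)) :
    Tendsto (fun i => ‖(nullMink (a i) (b i) (h i) (ω i)).2‖⁻¹ •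
      (nullMink (a i) (b i) (h i) (ω i)).2) l (𝓝 northPole.1) := by
  rw [tendsto_iff_norm_sub_tendsto_zero]
  have hsq : Tendsto (fun i => √(4 * (h i / (a i - b i)))) l (𝓝 0) := by
    simpa using (hlim.const_mul 4).sqrt
  refine squeeze_zero' (Eventually.of_forall fun _ => norm_nonneg _) ?_ hsq
  filter_upwards [hab, hh] with i h1 h2
  exact Real.le_sqrt_of_sq_le (norm_nullMink_direction_sub_sq_le h1 h2 _)

lemma tendsto_penroseMap_nullMink_past {α : Type*} {l : Filter α} {a b h : α → ℝ} {ω : α → S2}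
    (ha : ∀ᶠ i in l, 0 < a i) (hb : ∀ᶠ i in l, b i < 0) (ha0 : Tendsto a l (𝓝 0))
    (hh : Tendsto h l atTop) (hlim : Tendsto (fun i => h i ^ 2 / (-b i)) l (𝓝 0)) :
    Tendsto (fun i => penroseMap (nullMink (a i) (b i) (h i) (ω i))) l
      (𝓝 (scriPastPoint 0 northPole)) := by
  -- Eventually `h² ≤ -b` and `h ≥ 1`, so `-b` inherits the divergence of `h`.
  have hle : ∀ᶠ i in l, b i ≤ -h i := by
    filter_upwards [hb, hh.eventually_ge_atTop 1, hlim.eventually_le_const one_pos] with i h1 h2 h3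
    rw [div_le_one (by linarith)] at h3
    nlinarith
  refine tendsto_penroseMap_scriPast ?_ ?_ (tendsto_nullMink_direction ?_ ?_ ?_)
  · have h2 : Tendsto (fun i => a i + h i ^ 2 / (-b i)) l (𝓝 0) := by simpa using ha0.add hlim
    refine tendsto_of_tendsto_of_tendsto_of_le_of_le' ha0 h2
      (Eventually.of_forall fun i => le_nullMink_add_norm _ _ _ _) ?_
    filter_upwards [ha, hb] with i h3 h4 using nullMink_add_norm_le h3 h4 _
  · refine tendsto_atBot_mono' _ ?_ (tendsto_neg_atTop_atBot.comp hh)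
    filter_upwards [hle] with i hi using (nullMink_sub_norm_le _ _ _ _).trans hi
  · filter_upwards [ha, hb] with i h1 h2 using h2.trans h1
  · exact hh.eventually_gt_atTop 0
  · refine squeeze_zero' ?_ ?_ hlim
    · filter_upwards [ha, hb, hh.eventually_gt_atTop 0] with i h1 h2 h3
      exact div_nonneg h3.le (by linarith)
    · filter_upwards [ha, hb, hh.eventually_ge_atTop 1] with i h1 h2 h3
      have : h i ≤ h i ^ 2 := by nlinarith
      exact div_le_div₀ (by positivity) this (by linarith) (by linarith)

lemma tendsto_penroseMap_nullMink_future {α : Type*} {l : Filter α} {a b h : α → ℝ} {ω : α → S2}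
    (ha : ∀ᶠ i in l, 0 < a i) (hb : ∀ᶠ i in l, b i < 0) (hb0 : Tendsto b l (𝓝 0))
    (hh : Tendsto h l atTop) (hlim : Tendsto (fun i => h i ^ 2 / a i) l (𝓝 0)) :
    Tendsto (fun i => penroseMap (nullMink (a i) (b i) (h i) (ω i))) l
      (𝓝 (scriFuturePoint 0 northPole)) := by
  have hle : ∀ᶠ i in l, h i ≤ a i := by
    filter_upwards [ha, hh.eventually_ge_atTop 1, hlim.eventually_le_const one_pos] with i h1 h2 h3
    rw [div_le_one h1] at h3
    nlinarith
  refine tendsto_penroseMap_scriFuture ?_ ?_ (tendsto_nullMink_direction ?_ ?_ ?_)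
  · refine tendsto_atTop_mono' _ ?_ hh
    filter_upwards [hle] with i hi using hi.trans (le_nullMink_add_norm _ _ _ _)
  · have h2 : Tendsto (fun i => b i - h i ^ 2 / a i) l (𝓝 0) := by simpa using hb0.sub hlim
    refine tendsto_of_tendsto_of_tendsto_of_le_of_le' h2 hb0 ?_
      (Eventually.of_forall fun i => nullMink_sub_norm_le _ _ _ _)
    filter_upwards [ha, hb] with i h3 h4 using le_nullMink_sub_norm h3 h4 _
  · filter_upwards [ha, hb] with i h1 h2 using h2.trans h1
  · exact hh.eventually_gt_atTop 0
  · refine squeeze_zero' ?_ ?_ hlim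
    · filter_upwards [ha, hb, hh.eventually_gt_atTop 0] with i h1 h2 h3
      exact div_nonneg h3.le (by linarith)
    · filter_upwards [ha, hb, hh.eventually_ge_atTop 1] with i h1 h2 h3
      have : h i ≤ h i ^ 2 := by nlinarith
      exact div_le_div₀ (by positivity) this h1 (by linarith)

/-! ### The embedding near the null infinities of Schwarzschild. -/

/-- The conformal embedding as a function of unconstrained Kruskal coordinates. -/
def kruskalToMink (m r u v : ℝ) (ω : S2) : Mink :=
  nullMink (kFun m r * v) (kFun m r * u) (hFun m r) ω

lemma schwEmbedding_eq {m : ℝ} (x : Schw m) :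
    schwEmbedding m x = kruskalToMink m x.1.1 x.1.2.1 x.1.2.2.1 x.1.2.2.2 := by
  simp only [schwEmbedding, kruskalToMink, nullMink, mul_add, mul_sub]

/-- No limit of `u` is assumed: the Kruskal relation yields its sign for `r > 2m`, and its size
through `h²/(-ku) = v · h²/(k(-uv))`. -/
lemma tendsto_penroseMap_kruskalToMink_past {α : Type*} {l : Filter α} {m v₀ : ℝ} (hm : 0 < m)
    (hv₀ : 0 < v₀) {r u v : α → ℝ} {ω : α → S2} (hr : Tendsto r l atTop)
    (hv : Tendsto v l (𝓝 v₀))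
    (huv : ∀ᶠ i in l, u i * v i = (1 - r i / (2 * m)) * exp (r i / (2 * m))) :
    Tendsto (fun i => penroseMap (kruskalToMink m (r i) (u i) (v i) (ω i))) l
      (𝓝 (scriPastPoint 0 northPole)) := by
  have hbase : ∀ᶠ i in l, 0 < kFun m (r i) ∧ 0 < v i ∧ u i < 0 := by
    filter_upwards [hr.eventually_gt_atTop (2 * m), hv.eventually_const_lt hv₀, huv] with i h1 h2 h3
    refine ⟨kFun_pos hm (by linarith), h2, ?_⟩
    have h4 : 1 - r i / (2 * m) < 0 := by
      rw [sub_neg, lt_div_iff₀ (by positivity)]; linarith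
    have := mul_neg_of_neg_of_pos h4 (exp_pos (r i / (2 * m)))
    exact neg_of_mul_neg_left (h3 ▸ this) h2.le
  refine tendsto_penroseMap_nullMink_past ?_ ?_ ?_ ((tendsto_hFun_atTop hm).comp hr) ?_
  · filter_upwards [hbase] with i hi using mul_pos hi.1 hi.2.1
  · filter_upwards [hbase] with i hi using mul_neg_of_pos_of_neg hi.1 hi.2.2
  · simpa using ((tendsto_kFun_atTop hm).comp hr).mul hv
  · have h := ((tendsto_hFun_sq_div hm).comp hr).mul hv
    rw [zero_mul] at h
    refine h.congr' ?_
    filter_upwards [hbase, huv] with i ⟨hk, hvi, hui⟩ h3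
    have h4 : (r i / (2 * m) - 1) * exp (r i / (2 * m)) = -(u i) * v i := by linarith
    have h5 : -(u i) ≠ 0 := by linarith
    simp only [Function.comp_apply]
    rw [h4, ← mul_neg]
    field_simp

lemma tendsto_penroseMap_kruskalToMink_future {α : Type*} {l : Filter α} {m u₀ : ℝ} (hm : 0 < m)
    (hu₀ : u₀ < 0) {r u v : α → ℝ} {ω : α → S2} (hr : Tendsto r l atTop)
    (hu : Tendsto u l (𝓝 u₀))
    (huv : ∀ᶠ i in l, u i * v i = (1 - r i / (2 * m)) * exp (r i / (2 * m))) :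
    Tendsto (fun i => penroseMap (kruskalToMink m (r i) (u i) (v i) (ω i))) l
      (𝓝 (scriFuturePoint 0 northPole)) := by
  have hbase : ∀ᶠ i in l, 0 < kFun m (r i) ∧ 0 < v i ∧ u i < 0 := by
    filter_upwards [hr.eventually_gt_atTop (2 * m), hu.eventually_lt_const hu₀, huv] with i h1 h2 h3
    refine ⟨kFun_pos hm (by linarith), ?_, h2⟩
    have h4 : 1 - r i / (2 * m) < 0 := by
      rw [sub_neg, lt_div_iff₀ (by positivity)]; linarith
    have := mul_neg_of_neg_of_pos h4 (exp_pos (r i / (2 * m)))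
    exact pos_of_mul_neg_right (h3 ▸ this) h2.le
  refine tendsto_penroseMap_nullMink_future ?_ ?_ ?_ ((tendsto_hFun_atTop hm).comp hr) ?_
  · filter_upwards [hbase] with i hi using mul_pos hi.1 hi.2.1
  · filter_upwards [hbase] with i hi using mul_neg_of_pos_of_neg hi.1 hi.2.2
  · simpa using ((tendsto_kFun_atTop hm).comp hr).mul hu
  · have h := ((tendsto_hFun_sq_div hm).comp hr).mul hu.neg
    rw [zero_mul] at h
    refine h.congr' ?_
    filter_upwards [hbase, huv] with i ⟨hk, hvi, hui⟩ h3
    have h4 : (r i / (2 * m) - 1) * exp (r i / (2 * m)) = -(u i) * v i := by linarith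
    have h5 : -(u i) ≠ 0 := by linarith
    simp only [Function.comp_apply]
    rw [h4]
    generalize -(u i) = w at *
    field_simp

/-! ### The extended map and its continuity. -/

lemma scriPastPoint_zero_northPole_mem :
    scriPastPoint 0 northPole ∈ closure (range penroseMap) := by
  let ω : S2 := ⟨EuclideanSpace.single 0 1, by simp⟩
  -- An explicit curve with `a = 1/s → 0`, `h = s → ∞` and `h²/(-b) = 1/s → 0`.
  have : Tendsto (fun s : ℝ => penroseMap (nullMink s⁻¹ (-s ^ 3) s ω)) atTop
      (𝓝 (scriPastPoint 0 northPole)) := by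
    refine tendsto_penroseMap_nullMink_past ?_ ?_ tendsto_inv_atTop_zero tendsto_id ?_
    · filter_upwards [eventually_gt_atTop 0] with s hs using inv_pos.mpr hs
    · filter_upwards [eventually_gt_atTop 0] with s hs using neg_neg_of_pos (pow_pos hs 3)
    · refine tendsto_inv_atTop_zero.congr' ?_
      filter_upwards [eventually_gt_atTop 0] with s hs
      simp only [neg_neg]
      field_simp
  exact mem_closure_of_tendsto this (Eventually.of_forall fun _ => mem_range_self _)

lemma scriFuturePoint_zero_northPole_mem :
    scriFuturePoint 0 northPole ∈ closure (range penroseMap) := by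
  let ω : S2 := ⟨EuclideanSpace.single 0 1, by simp⟩
  have : Tendsto (fun s : ℝ => penroseMap (nullMink (s ^ 3) (-s⁻¹) s ω)) atTop
      (𝓝 (scriFuturePoint 0 northPole)) := by
    refine tendsto_penroseMap_nullMink_future ?_ ?_ ?_ tendsto_id ?_
    · filter_upwards [eventually_gt_atTop 0] with s hs using pow_pos hs 3
    · filter_upwards [eventually_gt_atTop 0] with s hs using neg_neg_of_pos (inv_pos.mpr hs)
    · simpa using (tendsto_inv_atTop_zero (𝕜 := ℝ)).neg
    · refine tendsto_inv_atTop_zero.congr' ?_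
      filter_upwards [eventually_gt_atTop 0] with s hs
      field_simp
  exact mem_closure_of_tendsto this (Eventually.of_forall fun _ => mem_range_self _)

open scoped Classical in
/-- The extension of the conformal embedding to null infinity, in the coordinates `(ℓ, u, v, ω)`
and with values in the Einstein cylinder. -/
def schwExtension (m : ℝ) (z : ℝ × EReal × EReal × S2) : EinsteinCylinder :=
  if 0 < z.1 then penroseMap (kruskalToMink m (1 / z.1) z.2.1.toReal z.2.2.1.toReal z.2.2.2)
  else if z.2.1 = ⊥ then scriPastPoint 0 northPole else scriFuturePoint 0 northPole

lemma schwExtension_mem (m : ℝ) (z : ℝ × EReal × EReal × S2) :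
    schwExtension m z ∈ closure (range penroseMap) := by
  unfold schwExtension
  split_ifs
  · exact subset_closure (mem_range_self _)
  · exact scriPastPoint_zero_northPole_mem
  · exact scriFuturePoint_zero_northPole_mem

lemma schwExtension_toBar {m : ℝ} (x : Schw m) :
    schwExtension m x.toBar.1 = penroseMap (schwEmbedding m x) := by
  have h : 0 < 1 / x.1.1 := one_div_pos.mpr x.2.1
  rw [schwEmbedding_eq, Schw.toBar, schwExtension, if_pos h]
  simp only [EReal.toReal_coe, one_div_one_div]

lemma schwExtension_past (m v : ℝ) (ω : S2) :
    schwExtension m (0, ⊥, v, ω) = scriPastPoint 0 northPole := by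
  simp [schwExtension]

lemma schwExtension_future (m u : ℝ) (ω : S2) :
    schwExtension m (0, u, ⊤, ω) = scriFuturePoint 0 northPole := by
  simp [schwExtension]

/-- The formula does not need the relation between `r`, `u` and `v`, so continuity holds in the
whole ambient product, without charts on the Kruskal hypersurface. -/
lemma continuousAt_schwExtension {m : ℝ} (hm : 0 < m) (x : Schw m) :
    ContinuousAt (schwExtension m) x.toBar.1 := by
  have hx := x.2.1
  set z := x.toBar.1 with hz
  have hz0 : 0 < z.1 := one_div_pos.mpr hx
  have hr : ContinuousAt (fun z : ℝ × EReal × EReal × S2 => 1 / z.1) z :=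
    continuousAt_const.div continuousAt_fst hz0.ne'
  have hrz : 0 < 1 / z.1 := one_div_pos.mpr hz0
  have hk := ContinuousAt.comp (f := fun z : ℝ × EReal × EReal × S2 => 1 / z.1)
    (continuousAt_kFun hm hrz) hr
  have hh := ContinuousAt.comp (f := fun z : ℝ × EReal × EReal × S2 => 1 / z.1)
    (continuousAt_hFun hm hrz) hr
  have hu : ContinuousAt (fun z : ℝ × EReal × EReal × S2 => z.2.1.toReal) z :=
    ContinuousAt.comp (g := EReal.toReal)
      (EReal.tendsto_toReal (EReal.coe_ne_top _) (EReal.coe_ne_bot _)) (by fun_prop)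
  have hv : ContinuousAt (fun z : ℝ × EReal × EReal × S2 => z.2.2.1.toReal) z :=
    ContinuousAt.comp (g := EReal.toReal)
      (EReal.tendsto_toReal (EReal.coe_ne_top _) (EReal.coe_ne_bot _)) (by fun_prop)
  have hω : ContinuousAt (fun z : ℝ × EReal × EReal × S2 => z.2.2.2) z := by fun_prop
  have hN : ContinuousAt (fun z : ℝ × EReal × EReal × S2 =>
      kruskalToMink m (1 / z.1) z.2.1.toReal z.2.2.1.toReal z.2.2.2) z :=
    continuous_nullMink.continuousAt.comp
      ((hk.mul hv).prodMk ((hk.mul hu).prodMk (hh.prodMk hω)))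
  have hP : ContinuousAt (fun z : ℝ × EReal × EReal × S2 =>
      penroseMap (kruskalToMink m (1 / z.1) z.2.1.toReal z.2.2.1.toReal z.2.2.2)) z :=
    ContinuousAt.comp (g := penroseMap)
      (continuousAt_penroseMap (nullMink_snd_ne_zero (hFun_pos hrz) _)) hN
  refine hP.congr ?_
  filter_upwards [continuousAt_fst.eventually_const_lt hz0] with w hw
  rw [schwExtension, if_pos hw]

lemma SchwBar.toReal_mul_toReal {m : ℝ} (z : SchwBar m) (hz : 0 < z.1.1) :
    z.1.2.1.toReal * z.1.2.2.1.toReal =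
      (1 - 1 / z.1.1 / (2 * m)) * exp (1 / z.1.1 / (2 * m)) := by
  obtain ⟨z, ⟨x, rfl⟩ | ⟨v, ω, hv, rfl⟩ | ⟨u, ω, hu, rfl⟩⟩ := z
  · simpa using x.2.2
  · simp at hz
  · simp at hz

lemma SchwBar.eq_bot_or_eq_top {m : ℝ} (z : SchwBar m) (hz : ¬ 0 < z.1.1) :
    (z.1.2.1 = ⊥ ∧ z.1.2.2.1 ≠ ⊤) ∨ (z.1.2.1 ≠ ⊥ ∧ z.1.2.2.1 = ⊤) := by
  obtain ⟨z, ⟨x, rfl⟩ | ⟨v, ω, hv, rfl⟩ | ⟨u, ω, hu, rfl⟩⟩ := z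
  · exact absurd (one_div_pos.mpr x.2.1) hz
  · simp
  · simp

lemma SchwBar.tendsto_radius {m : ℝ} {z : SchwBar m} (hz : z.1.1 = 0) :
    Tendsto (fun w : SchwBar m => 1 / w.1.1) (𝓝 z ⊓ 𝓟 {w | 0 < w.1.1}) atTop := by
  have hc : Continuous fun w : SchwBar m => w.1.1 := continuous_fst.comp continuous_subtype_val
  have h : Tendsto (fun w : SchwBar m => w.1.1) (𝓝 z ⊓ 𝓟 {w | 0 < w.1.1}) (𝓝[>] 0) :=
    tendsto_nhdsWithin_iff.mpr ⟨(hz ▸ hc.tendsto z).mono_left inf_le_left,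
      eventually_inf_principal.mpr (Eventually.of_forall fun _ hw => hw)⟩
  simpa [Function.comp_def] using tendsto_inv_nhdsGT_zero.comp h

/-- At a boundary point the neighbourhood is split. Where `ℓ > 0`, `r → ∞` and the limits above
apply. Where `ℓ = 0`, the open condition `v < ⊤` (respectively `u > ⊥`) keeps nearby points on the
same null infinity, where the extension is constant. -/
lemma continuous_schwExtension {m : ℝ} (hm : 0 < m) :
    Continuous fun z : SchwBar m => schwExtension m z.1 := by
  rw [continuous_iff_continuousAt]
  intro z
  have hcu : Continuous fun w : SchwBar m => w.1.2.1 :=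
    continuous_fst.comp (continuous_snd.comp continuous_subtype_val)
  have hcv : Continuous fun w : SchwBar m => w.1.2.2.1 :=
    continuous_fst.comp (continuous_snd.comp (continuous_snd.comp continuous_subtype_val))
  have huv : ∀ᶠ w : SchwBar m in 𝓝 z ⊓ 𝓟 {w | 0 < w.1.1},
      w.1.2.1.toReal * w.1.2.2.1.toReal =
        (1 - 1 / w.1.1 / (2 * m)) * exp (1 / w.1.1 / (2 * m)) :=
    eventually_inf_principal.mpr (Eventually.of_forall SchwBar.toReal_mul_toReal)
  obtain ⟨x, hx⟩ | ⟨v, ω, hv, hz⟩ | ⟨u, ω, hu, hz⟩ := z.2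
  · have h : z = x.toBar := Subtype.ext hx
    subst h
    exact (continuousAt_schwExtension hm x).comp continuous_subtype_val.continuousAt
  · rw [ContinuousAt, hz, schwExtension_past]
    refine Tendsto.if ?_ ?_
    · refine tendsto_penroseMap_kruskalToMink_past hm hv
        (SchwBar.tendsto_radius (by rw [hz])) ?_ huv
      have h1 := EReal.tendsto_toReal (EReal.coe_ne_top v) (EReal.coe_ne_bot v)
      have h2 := hcv.tendsto z
      simp only [hz] at h2
      exact (h1.comp h2).mono_left inf_le_left
    · refine tendsto_const_nhds.congr' ?_
      rw [EventuallyEq, eventually_inf_principal]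
      have h2 := hcv.tendsto z
      simp only [hz] at h2
      filter_upwards [h2.eventually_lt_const (EReal.coe_lt_top v)] with w hw hw0
      have h3 := (w.eq_bot_or_eq_top hw0).resolve_right fun h => hw.ne h.2
      rw [if_pos h3.1]
  · rw [ContinuousAt, hz, schwExtension_future]
    refine Tendsto.if ?_ ?_
    · refine tendsto_penroseMap_kruskalToMink_future hm hu
        (SchwBar.tendsto_radius (by rw [hz])) ?_ huv
      have h1 := EReal.tendsto_toReal (EReal.coe_ne_top u) (EReal.coe_ne_bot u)
      have h2 := hcu.tendsto z
      simp only [hz] at h2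
      exact (h1.comp h2).mono_left inf_le_left
    · refine tendsto_const_nhds.congr' ?_
      rw [EventuallyEq, eventually_inf_principal]
      have h2 := hcu.tendsto z
      simp only [hz] at h2
      filter_upwards [h2.eventually_const_lt (EReal.bot_lt_coe u)] with w hw hw0
      rw [if_neg hw.ne']

end

theorem proposition5p1 (m : ℝ) (hm : 0 < m) :
    ∃ F : SchwBar m → MinkBar,
      Continuous F ∧
      (∀ x : Schw m, F x.toBar = Mink.toBar (schwEmbedding m x)) ∧
      (∃ pPast ∈ scriPastMink,
        pPast.1 = scriPastPoint 0 northPole ∧ F '' scriPastSchw m = {pPast}) ∧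
      (∃ pFuture ∈ scriFutureMink,
        pFuture.1 = scriFuturePoint 0 northPole ∧ F '' scriFutureSchw m = {pFuture}) := by
  let ω : S2 := ⟨EuclideanSpace.single 0 1, by simp⟩
  refine ⟨fun z => ⟨schwExtension m z.1, schwExtension_mem m z.1⟩,
    (continuous_schwExtension hm).subtype_mk _, fun x => Subtype.ext (schwExtension_toBar x),
    ⟨⟨_, scriPastPoint_zero_northPole_mem⟩, ⟨0, northPole, rfl⟩, rfl, ?_⟩,
    ⟨⟨_, scriFuturePoint_zero_northPole_mem⟩, ⟨0, northPole, rfl⟩, rfl, ?_⟩⟩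
  · refine eq_singleton_iff_unique_mem.mpr ⟨?_, ?_⟩
    · exact ⟨⟨(0, ⊥, ((1 : ℝ) : EReal), ω), Or.inr (Or.inl ⟨1, ω, one_pos, rfl⟩)⟩,
        ⟨1, ω, one_pos, rfl⟩, Subtype.ext (schwExtension_past m 1 ω)⟩
    · rintro _ ⟨z, ⟨v, ω, -, hz⟩, rfl⟩
      exact Subtype.ext (by simp only [hz, schwExtension_past])
  · refine eq_singleton_iff_unique_mem.mpr ⟨?_, ?_⟩
    · exact ⟨⟨(0, ((-1 : ℝ) : EReal), ⊤, ω), Or.inr (Or.inr ⟨-1, ω, by norm_num, rfl⟩)⟩,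
        ⟨-1, ω, by norm_num, rfl⟩, Subtype.ext (schwExtension_future m (-1) ω)⟩
    · rintro _ ⟨z, ⟨u, ω, -, hz⟩, rfl⟩
      exact Subtype.ext (by simp only [hz, schwExtension_future])
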